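/- Let $d\ge 1$, $\mathbb{D}=\{z\in\mathbb{C}:|z|<1\}$, and let $A_{\mathrm{sym}}(\mathbb{D}^d)$ be the complex commutative unital Banach algebra (pointwise operations, supremum norm) of all continuous functions $f:\overline{\mathbb{D}}^d\to\mathbb{C}$ that are holomorphic in $\mathbb{D}^d$ and symmetric, i.e. $f(z_1,\dots,z_d)=f(z_{\sigma(1)},\dots,z_{\sigma(d)})$ for all $\mathbf z=(z_1,\dots,z_d)\in\mathbb{D}^d$ and all permutations $\sigma\in S_d$. Let $M$ be its maximal ideal space, i.e. the set of all nonzero multiplicative linear functionals $\varphi:A_{\mathrm{sym}}(\mathbb{D}^d)\to\mathbb{C}$. Let $\overline{\mathbb{D}}^d/\!\sim$ be the space of orbits $[\mathbf z]$ of $\overline{\mathbb{D}}^d$ under the action of $S_d$ by permutation of coordinates, with the quotient topology. Then every $\varphi\in M$ is continuous, and, when $M$ carries the Gelfand topology (induced by the weak-$*$ topology of the dual space), the map $$\iota:\ \overline{\mathbb{D}}^d/\!\sim\ \longrightarrow\ M,\qquad \iota([\mathbf z])(f)=f(\mathbf z)\quad (f\in A_{\mathrm{sym}}(\mathbb{D}^d)),$$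 is a well-defined homeomorphism. In particular, $M$ is homeomorphic to $\overline{\mathbb{D}}^d/\!\sim$. -/

import Mathlib

namespace SymPolydisc

/-- The open polydisc `𝔻^d`. -/
def openPolydisc (d : ℕ) : Set (Fin d → ℂ) := {z | ∀ i, ‖z i‖ < 1}

/-- The closed polydisc, with the subspace topology from `ℂ^d`. -/
abbrev ClosedPolydisc (d : ℕ) : Type := {z : Fin d → ℂ // ∀ i, ‖z i‖ ≤ 1}

instance (d : ℕ) : CompactSpace (ClosedPolydisc d) := by
  refine (isCompact_iff_compactSpace (s := {z : Fin d → ℂ | ∀ i, ‖z i‖ ≤ 1})).mp ?_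
  have h : IsCompact (Set.univ.pi fun _ : Fin d => Metric.closedBall (0 : ℂ) 1) :=
    isCompact_univ_pi fun _ => isCompact_closedBall 0 1
  convert h using 1
  ext z
  simp [Set.mem_pi]

/-- `σ z = (z_{σ(1)}, …, z_{σ(d)})`. -/
def permute {d : ℕ} (σ : Equiv.Perm (Fin d)) (z : ClosedPolydisc d) : ClosedPolydisc d :=
  ⟨fun i => z.1 (σ i), fun i => z.2 (σ i)⟩

/-- The polydisc algebra: continuous functions on the closed polydisc that are holomorphic
in the open polydisc. The norm inherited from `C(ClosedPolydisc d, ℂ)` is the supremum over the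
closed polydisc, which by continuity is the supremum over the open one. -/
def polydiscAlgebra (d : ℕ) : Subalgebra ℂ C(ClosedPolydisc d, ℂ) where
  carrier := {f | ∃ F : (Fin d → ℂ) → ℂ, DifferentiableOn ℂ F (openPolydisc d) ∧
    ∀ z : ClosedPolydisc d, z.1 ∈ openPolydisc d → F z.1 = f z}
  mul_mem' := by
    rintro f g ⟨F, hF, hFf⟩ ⟨G, hG, hGg⟩
    exact ⟨fun z => F z * G z, hF.mul hG, fun z hz => by simp [hFf z hz, hGg z hz]⟩
  add_mem' := by
    rintro f g ⟨F, hF, hFf⟩ ⟨G, hG, hGg⟩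
    exact ⟨fun z => F z + G z, hF.add hG, fun z hz => by simp [hFf z hz, hGg z hz]⟩
  algebraMap_mem' c := ⟨fun _ => c, differentiableOn_const c, fun z _ => by simp⟩

/-- The symmetric functions in the polydisc algebra. -/
def symPolydiscAlgebra (d : ℕ) : Subalgebra ℂ C(ClosedPolydisc d, ℂ) where
  carrier := {f | f ∈ polydiscAlgebra d ∧
    ∀ z : ClosedPolydisc d, z.1 ∈ openPolydisc d →
      ∀ σ : Equiv.Perm (Fin d), f z = f (permute σ z)}
  mul_mem' := by
    rintro f g ⟨hf, hf'⟩ ⟨hg, hg'⟩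
    exact ⟨mul_mem hf hg, fun z hz σ => by
      rw [ContinuousMap.mul_apply, ContinuousMap.mul_apply, hf' z hz σ, hg' z hz σ]⟩
  add_mem' := by
    rintro f g ⟨hf, hf'⟩ ⟨hg, hg'⟩
    exact ⟨add_mem hf hg, fun z hz σ => by
      rw [ContinuousMap.add_apply, ContinuousMap.add_apply, hf' z hz σ, hg' z hz σ]⟩
  algebraMap_mem' c := ⟨algebraMap_mem _ c, fun z _ σ => by simp⟩

/-- `z ∼ w` if `w = σ z` for some permutation `σ` of the coordinates. -/
def orbitSetoid (d : ℕ) : Setoid (ClosedPolydisc d) where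
  r z w := ∃ σ : Equiv.Perm (Fin d), w = permute σ z
  iseqv :=
    { refl := fun z => ⟨1, rfl⟩
      symm := by
        rintro z w ⟨σ, rfl⟩
        exact ⟨σ⁻¹, Subtype.ext (funext fun i => by simp [permute])⟩
      trans := by
        rintro z w u ⟨σ, rfl⟩ ⟨τ, rfl⟩
        exact ⟨σ * τ, rfl⟩ }

/-- The orbit space, with the quotient topology. -/
abbrev OrbitSpace (d : ℕ) : Type := Quotient (orbitSetoid d)

end SymPolydisc

/-!
If a finite group `G` acts on a commutative `ℂ`-algebra `B`, every character of the invariant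
algebra `A = B^G` is the restriction of a character of `B`, because `B` is integral over `A`, and
two characters of `B` with the same restriction differ by an element of `G`, because `G` permutes
transitively the primes of `B` over a given prime of `A`. The symmetric functions are the
invariants of `S_d` in the polydisc algebra, so it remains to see that the characters of the
polydisc algebra are the evaluations at points.

A character takes each `f` to a value of `f`, hence is contractive, and it agrees with an evaluation
on the coordinates; so it is enough that polynomials are dense. A function `f` of the polydisc
algebra is the uniform limit of its dilates `z ↦ f (r z)`, `r < 1`, and by Cauchy's integral formula
such a dilate is the value at `(r z₁, …, r z_d)` of the holomorphic functional calculus, computed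
inside any closed subalgebra that contains the coordinates.
-/

namespace SymPolydisc

open Complex MeasureTheory Metric
open scoped Real

section InvariantAlgebra

theorem exists_algHom_comp_eq_of_isIntegral {k A B : Type*} [Field k] [IsAlgClosed k] [CommRing A]
    [CommRing B] [Algebra k A] [Algebra k B] {j : A →ₐ[k] B} (hj : Function.Injective j)
    (hint : (j : A →+* B).IsIntegral) (φ : A →ₐ[k] k) : ∃ ψ : B →ₐ[k] k, ψ.comp j = φ := by
  let _ : Algebra A B := (j : A →+* B).toAlgebra
  have : Algebra.IsIntegral A B := algebraMap_isIntegral_iff.1 hint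
  have : FaithfulSMul A B := (faithfulSMul_iff_algebraMap_injective A B).2 hj
  have hφ : Function.Surjective φ := fun c => ⟨algebraMap k A c, φ.commutes c⟩
  have : (RingHom.ker φ).IsMaximal := RingHom.ker_isMaximal_of_surjective φ hφ
  obtain ⟨Q, hQ, ⟨hQφ⟩⟩ :=
    Ideal.exists_maximal_ideal_liesOver_of_isIntegral (S := B) (RingHom.ker φ)
  have hfactor : (Ideal.Quotient.mk Q).comp (j : A →+* B) =
      (algebraMap k (B ⧸ Q)).comp (φ : A →+* k) := by
    ext a
    have hmem : a - algebraMap k A (φ a) ∈ RingHom.ker φ := by simp [RingHom.mem_ker]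
    have hmemQ : j (a - algebraMap k A (φ a)) ∈ Q := by rwa [hQφ] at hmem
    rw [map_sub, AlgHom.commutes] at hmemQ
    exact Ideal.Quotient.eq.2 hmemQ
  have hQint : (algebraMap k (B ⧸ Q)).IsIntegral := by
    refine RingHom.IsIntegral.tower_top (φ : A →+* k) _ ?_
    rw [← hfactor]
    exact hint.trans _ _ (RingHom.isIntegral_of_surjective _ Ideal.Quotient.mk_surjective)
  let e : k ≃ₐ[k] B ⧸ Q := AlgEquiv.ofBijective (Algebra.ofId k (B ⧸ Q))
    (IsAlgClosed.ringHom_bijective_of_isIntegral _ hQint)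
  refine ⟨e.symm.toAlgHom.comp (Ideal.Quotient.mkₐ k Q), AlgHom.ext fun a => e.injective ?_⟩
  exact (e.apply_symm_apply _).trans (RingHom.congr_fun hfactor a)

variable {k A B G : Type*} [CommRing k] [CommRing A] [CommRing B] [Algebra k A] [Algebra k B]
  [Group G] [Finite G] {j : A →ₐ[k] B} {ρ : G →* (B ≃ₐ[k] B)}

theorem isIntegral_of_forall_fixed_mem_range
    (hρ : ∀ b, (∀ g, ρ g b = b) → b ∈ j.range) : (j : A →+* B).IsIntegral := by
  let _ : Algebra A B := (j : A →+* B).toAlgebra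
  let _ : MulSemiringAction G B := MulSemiringAction.compHom B ρ
  have : Algebra.IsInvariant A B G := ⟨hρ⟩
  exact algebraMap_isIntegral_iff.2 (Algebra.IsInvariant.isIntegral A B G)

theorem exists_comp_algEquiv_eq_of_comp_eq [IsDomain k] (hρ : ∀ b, b ∈ j.range ↔ ∀ g, ρ g b = b)
    {ψ χ : B →ₐ[k] k} (h : ψ.comp j = χ.comp j) : ∃ g, ψ.comp (ρ g : B →ₐ[k] B) = χ := by
  let _ : Algebra A B := (j : A →+* B).toAlgebra
  let _ : MulSemiringAction G B := MulSemiringAction.compHom B ρ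
  have : Algebra.IsInvariant A B G := ⟨fun b => (hρ b).2⟩
  have : SMulCommClass G A B := ⟨fun g a b => by
    change ρ g (j a * b) = j a * ρ g b
    rw [map_mul, (hρ (j a)).1 ⟨a, rfl⟩ g]⟩
  have hker : (RingHom.ker ψ).under A = (RingHom.ker χ).under A :=
    Ideal.ext fun a => by
      change ψ (j a) = 0 ↔ χ (j a) = 0
      rw [← AlgHom.comp_apply, h, AlgHom.comp_apply]
  obtain ⟨g, hg⟩ := Algebra.IsInvariant.exists_smul_of_under_eq A B G
    (hP := RingHom.ker_isPrime ψ) (hQ := RingHom.ker_isPrime χ) _ _ hker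
  refine ⟨g⁻¹, AlgHom.ext fun b => ?_⟩
  have hmem : b - algebraMap k B (χ b) ∈ RingHom.ker χ := by simp [RingHom.mem_ker]
  rw [hg, Ideal.mem_pointwise_smul_iff_inv_smul_mem] at hmem
  have hzero : ψ (ρ g⁻¹ (b - algebraMap k B (χ b))) = 0 := hmem
  rw [map_sub, AlgEquiv.commutes, map_sub, AlgHom.commutes] at hzero
  exact sub_eq_zero.1 hzero

end InvariantAlgebra

section Cauchy

variable {n : ℕ} {E : Type*} [NormedAddCommGroup E]

theorem continuous_torusMap (c : Fin n → ℂ) (R : Fin n → ℝ) : Continuous (torusMap c R) := by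
  unfold torusMap
  fun_prop

theorem torusMap_mem_sphere (c : Fin n → ℂ) {R : Fin n → ℝ} {i : Fin n} (hR : 0 ≤ R i)
    (θ : Fin n → ℝ) : torusMap c R θ i ∈ sphere (c i) (R i) :=
  circleMap_mem_sphere (c i) hR (θ i)

theorem torusIntegrable_of_continuousOn {f : (Fin n → ℂ) → E} {c : Fin n → ℂ} {R : Fin n → ℝ}
    (hR : ∀ i, 0 ≤ R i) (hf : ContinuousOn f (Set.univ.pi fun i => sphere (c i) (R i))) :
    TorusIntegrable f c R :=
  (hf.comp_continuous (continuous_torusMap c R)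
    fun θ i _ => torusMap_mem_sphere c (hR i) θ).continuousOn.integrableOn_compact isCompact_Icc

variable [NormedSpace ℂ E]

theorem continuousOn_prod_sub_inv_smul {F : (Fin n → ℂ) → E} {c z : Fin n → ℂ} {R : Fin n → ℝ}
    (hF : ContinuousOn F (Set.univ.pi fun i => sphere (c i) (R i)))
    (hz : ∀ i, z i ∈ ball (c i) (R i)) :
    ContinuousOn (fun w => (∏ i, (w i - z i)⁻¹) • F w)
      (Set.univ.pi fun i => sphere (c i) (R i)) := by
  refine ContinuousOn.smul (continuousOn_finsetProd _ fun i _ => ContinuousOn.inv₀ (by fun_prop)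
    fun w hw => sub_ne_zero.2 ?_) hF
  intro hwz
  exact (hwz ▸ hz i : w i ∈ ball (c i) (R i)).ne (hw i (Set.mem_univ i))

theorem torusIntegral_prod_sub_inv_smul [CompleteSpace E] {F : (Fin n → ℂ) → E}
    {c z : Fin n → ℂ} {R : Fin n → ℝ}
    (hF : DifferentiableOn ℂ F (Set.univ.pi fun i => closedBall (c i) (R i)))
    (hz : ∀ i, z i ∈ ball (c i) (R i)) :
    (∯ w in T(c, R), (∏ i, (w i - z i)⁻¹) • F w) = (2 * π * I : ℂ) ^ n • F z := by
  induction n with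
  | zero => simp [torusIntegral_dim0, Subsingleton.elim z c]
  | succ n ih =>
    have hR : ∀ i, 0 ≤ R i := fun i => (pos_of_mem_ball (hz i)).le
    have hslice : ∀ x ∈ closedBall (c 0) (R 0), DifferentiableOn ℂ
        (fun y : Fin n → ℂ => F (Fin.cons x y))
        (Set.univ.pi fun i => closedBall ((c ∘ Fin.succ) i) ((R ∘ Fin.succ) i)) := by
      refine fun x hx => hF.comp ?_ fun y hy => ?_
      · exact (differentiable_pi.2 (Fin.cases (by simp) fun j => by
          simp only [Fin.cons_succ]
          fun_prop)).differentiableOn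
      · simpa [Set.mem_pi, Fin.forall_fin_succ] using And.intro hx (by simpa [Set.mem_pi] using hy)
    have hinner : ∀ x ∈ sphere (c 0) (R 0),
        (∯ y in T(c ∘ Fin.succ, R ∘ Fin.succ),
          (∏ i, ((Fin.cons x y : Fin (n + 1) → ℂ) i - z i)⁻¹) • F (Fin.cons x y)) =
        (x - z 0)⁻¹ • (2 * π * I : ℂ) ^ n • F (Fin.cons x (Fin.tail z)) := by
      intro x hx
      rw [← ih (z := Fin.tail z) (hslice x (sphere_subset_closedBall hx)) (fun i => hz i.succ),
        ← torusIntegral_smul]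
      simp only [Fin.prod_univ_succ, Fin.cons_zero, Fin.cons_succ, mul_smul, Fin.tail]
    have houter : DifferentiableOn ℂ
        (fun x : ℂ => (2 * π * I : ℂ) ^ n • F (Fin.cons x (Fin.tail z)))
        (closedBall (c 0) (R 0)) := by
      refine (hF.comp ?_ fun x hx => ?_).const_smul _
      · exact (differentiable_pi.2 (Fin.cases (by simp) fun j => by simp)).differentiableOn
      · simpa [Set.mem_pi, Fin.forall_fin_succ, Fin.tail] using
          And.intro hx fun j : Fin n => (hz j.succ).le
    have hkernel := continuousOn_prod_sub_inv_smul (hF.continuousOn.mono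
      (Set.pi_mono fun i _ => sphere_subset_closedBall)) hz
    rw [torusIntegral_succ (torusIntegrable_of_continuousOn hR hkernel),
      circleIntegral.integral_congr (hR 0) hinner, houter.circleIntegral_sub_inv_smul (hz 0),
      Fin.cons_self_tail, smul_smul, pow_succ']

end Cauchy

section FunctionalCalculus

theorem algHom_resolvent {K A : Type*} [Field K] [Ring A] [Algebra K A] (χ : A →ₐ[K] K) {a : A}
    {w : K} (hw : w ∈ resolventSet K a) : χ (resolvent a w) = (w - χ a)⁻¹ := by
  refine eq_inv_of_mul_eq_one_left ?_
  rw [← map_one χ, ← Ring.inverse_mul_cancel _ hw, map_mul, map_sub, AlgHom.commutes]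
  rfl

theorem exists_forall_algHom_apply_eq {B : Type*} [NormedCommRing B] [NormedAlgebra ℂ B]
    [CompleteSpace B] {n : ℕ} {b : Fin n → B} {c : Fin n → ℂ} {R : Fin n → ℝ} {F : (Fin n → ℂ) → ℂ}
    (hF : DifferentiableOn ℂ F (Set.univ.pi fun i => closedBall (c i) (R i)))
    (hb : ∀ i, spectrum ℂ (b i) ⊆ ball (c i) (R i)) :
    ∃ g : B, ∀ χ : B →ₐ[ℂ] ℂ, χ g = F fun i => χ (b i) := by
  have hres : ∀ i, ∀ w ∈ sphere (c i) (R i), w ∈ resolventSet ℂ (b i) := fun i w hw =>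
    spectrum.notMem_iff.1 fun hwb => (hb i hwb).ne hw
  let G : (Fin n → ℂ) → B := fun w => F w • ∏ i, resolvent (b i) (w i)
  have hG : ContinuousOn G (Set.univ.pi fun i => sphere (c i) (R i)) := by
    refine (hF.continuousOn.mono (Set.pi_mono fun i _ => sphere_subset_closedBall)).smul
      (continuousOn_finsetProd _ fun i _ w hw => ?_)
    have hcont := (spectrum.hasDerivAt_resolvent_const_left
      (hres i (w i) (hw i (Set.mem_univ i)))).continuousAt
    exact (hcont.comp (f := fun w : Fin n → ℂ => w i)
      (continuous_apply i).continuousAt).continuousWithinAt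
  refine ⟨((2 * π * I : ℂ) ^ n)⁻¹ • ∯ w in T(c, R), G w, fun χ => ?_⟩
  have hχb : ∀ i, χ (b i) ∈ ball (c i) (R i) := fun i => hb i (AlgHom.apply_mem_spectrum χ (b i))
  have hR : ∀ i, 0 ≤ R i := fun i => (pos_of_mem_ball (hχb i)).le
  have hχG : ∀ θ, χ (G (torusMap c R θ)) =
      (∏ i, (torusMap c R θ i - χ (b i))⁻¹) • F (torusMap c R θ) := fun θ => by
    rw [map_smul, map_prod, smul_eq_mul, smul_eq_mul, mul_comm]
    congr 1
    exact Finset.prod_congr rfl fun i _ =>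
      algHom_resolvent χ (hres i _ (torusMap_mem_sphere c (hR i) θ))
  have hχ : χ (∯ w in T(c, R), G w) = (2 * π * I : ℂ) ^ n • F fun i => χ (b i) := by
    rw [← torusIntegral_prod_sub_inv_smul hF hχb, torusIntegral, torusIntegral]
    refine (χ.toContinuousLinearMap.integral_comp_comm
      (torusIntegrable_of_continuousOn hR hG).function_integrable).symm.trans ?_
    simp only [AlgHom.coe_toContinuousLinearMap, map_smul, hχG]
  rw [map_smul, hχ, inv_smul_smul₀ (pow_ne_zero _ two_pi_I_ne_zero)]

end FunctionalCalculus

section Evaluation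

variable {X : Type*} [TopologicalSpace X] (S : Subalgebra ℂ C(X, ℂ))

/-- Evaluation at a point, as a unital algebra homomorphism on an algebra of continuous
functions. -/
noncomputable def evalAlgHom (x : X) : S →ₐ[ℂ] ℂ := (ContinuousMap.evalAlgHom ℂ ℂ x).comp S.val

theorem continuous_evalAlgHom (x : X) : Continuous (evalAlgHom S x) :=
  (ContinuousEvalConst.continuous_eval_const x).comp continuous_subtype_val

/-- Evaluation at a point, as a point of the Gelfand spectrum. -/
noncomputable def evalCharacter (x : X) : WeakDual.characterSpace ℂ S :=
  ⟨StrongDual.toWeakDual ⟨(evalAlgHom S x).toLinearMap, continuous_evalAlgHom S x⟩,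
    fun h => one_ne_zero (α := ℂ) (DFunLike.congr_fun h (1 : S)),
    fun f g => map_mul (evalAlgHom S x) f g⟩

theorem continuous_evalCharacter : Continuous (evalCharacter S) :=
  (WeakDual.continuous_of_continuous_eval fun f => f.1.continuous).subtype_mk _

end Evaluation

variable {d : ℕ}

section Density

/-- The dilations `(r, z) ↦ r z` of the closed polydisc, for `r ∈ [0, 1]`. -/
def dilation (d : ℕ) : C(unitInterval × ClosedPolydisc d, ClosedPolydisc d) where
  toFun p := ⟨fun i => ((p.1 : ℝ) : ℂ) * p.2.1 i, fun i => by
    rw [norm_mul, norm_real, Real.norm_of_nonneg p.1.2.1]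
    exact mul_le_one₀ p.1.2.2 (norm_nonneg _) (p.2.2 i)⟩
  continuous_toFun := Continuous.subtype_mk (continuous_pi fun i => (by fun_prop :
    Continuous fun p : unitInterval × ClosedPolydisc d => ((p.1 : ℝ) : ℂ)).mul
      ((continuous_apply i).comp (continuous_subtype_val.comp continuous_snd))) _

theorem dilation_apply (r : unitInterval) (z : ClosedPolydisc d) (i : Fin d) :
    (dilation d (r, z)).1 i = (r : ℝ) * z.1 i := rfl

theorem dilation_one (z : ClosedPolydisc d) : dilation d (1, z) = z :=
  Subtype.ext (funext fun i => by simp [dilation_apply])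

theorem dilation_mem_openPolydisc {r : unitInterval} (hr : r < 1) (z : ClosedPolydisc d) :
    (dilation d (r, z)).1 ∈ openPolydisc d := fun i => by
  rw [dilation_apply, norm_mul, norm_real, Real.norm_of_nonneg r.2.1]
  exact (mul_le_of_le_one_right r.2.1 (z.2 i)).trans_lt hr

theorem one_mem_closure_Iio_unitInterval : (1 : unitInterval) ∈ closure (Set.Iio 1) := by
  rw [closure_Iio' ⟨0, zero_lt_one⟩]
  exact Set.self_mem_Iic

theorem dense_openPolydisc (d : ℕ) : Dense {z : ClosedPolydisc d | z.1 ∈ openPolydisc d} := by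
  intro z
  have hcont : Continuous fun r : unitInterval => dilation d (r, z) := by fun_prop
  simpa only [dilation_one] using map_mem_closure hcont one_mem_closure_Iio_unitInterval
    fun r hr => dilation_mem_openPolydisc hr z

/-- The coordinate functions, as elements of the polydisc algebra. -/
def coordinate (i : Fin d) : polydiscAlgebra d :=
  ⟨⟨fun z => z.1 i, (continuous_apply i).comp continuous_subtype_val⟩, fun z => z i,
    by fun_prop, fun _ _ => rfl⟩

variable {S : Subalgebra ℂ C(ClosedPolydisc d, ℂ)}

theorem comp_dilation_mem_of_isClosed (hS : IsClosed (S : Set C(ClosedPolydisc d, ℂ)))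
    (hcoord : ∀ i, (coordinate i).1 ∈ S) {f : C(ClosedPolydisc d, ℂ)}
    (hf : f ∈ polydiscAlgebra d) {r : unitInterval} (hr : r < 1) :
    (f.comp (dilation d)).curry r ∈ S := by
  obtain ⟨F, hF, hFf⟩ := hf
  have : CompleteSpace S := hS.completeSpace_coe
  obtain ⟨R, hrR, hR⟩ := exists_between (show (r : ℝ) < 1 from hr)
  let b : Fin d → S := fun i => ((r : ℝ) : ℂ) • ⟨(coordinate i).1, hcoord i⟩
  have hb : ∀ i, ‖b i‖ ≤ r := fun i => (ContinuousMap.norm_le _ r.2.1).2 fun z => by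
    change ‖((r : ℝ) : ℂ) * z.1 i‖ ≤ r
    rw [norm_mul, norm_real, Real.norm_of_nonneg r.2.1]
    exact mul_le_of_le_one_right r.2.1 (z.2 i)
  have hone : ‖(1 : S)‖ ≤ 1 := (ContinuousMap.norm_le _ zero_le_one).2 fun z => norm_one.le
  obtain ⟨g, hg⟩ := exists_forall_algHom_apply_eq (c := 0) (R := fun _ => R) (b := b)
    (hF.mono fun w hw i => (mem_closedBall_zero_iff.1 (hw i trivial)).trans_lt hR)
    (fun i w hw => mem_ball_zero_iff.2 <| (spectrum.norm_le_norm_mul_of_mem hw).trans_lt <|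
      (mul_le_of_le_one_right (norm_nonneg _) hone).trans_lt ((hb i).trans_lt hrR))
  convert g.2
  ext z
  exact (hFf _ (dilation_mem_openPolydisc hr z)).symm.trans (hg (evalAlgHom S z)).symm

theorem polydiscAlgebra_le_of_isClosed (hS : IsClosed (S : Set C(ClosedPolydisc d, ℂ)))
    (hcoord : ∀ i, (coordinate i).1 ∈ S) : polydiscAlgebra d ≤ S := by
  intro f hf
  have hone : (f.comp (dilation d)).curry 1 = f := ContinuousMap.ext fun z =>
    congrArg f (dilation_one z)
  rw [← SetLike.mem_coe, ← hS.closure_eq, ← hone]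
  exact map_mem_closure (ContinuousMap.continuous _) one_mem_closure_Iio_unitInterval
    fun r hr => comp_dilation_mem_of_isClosed hS hcoord hf hr

theorem dense_adjoin_coordinate (d : ℕ) :
    Dense (Algebra.adjoin ℂ (Set.range (coordinate (d := d))) : Set (polydiscAlgebra d)) := by
  rw [Subtype.dense_iff]
  let P := (Algebra.adjoin ℂ (Set.range (coordinate (d := d)))).map (polydiscAlgebra d).val
  exact polydiscAlgebra_le_of_isClosed P.isClosed_topologicalClosure fun i =>
    P.le_topologicalClosure ⟨coordinate i, Algebra.subset_adjoin ⟨i, rfl⟩, rfl⟩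

end Density

section PolydiscCharacters

theorem isUnit_of_forall_apply_ne_zero {f : polydiscAlgebra d} (hf : ∀ z, f.1 z ≠ 0) :
    IsUnit f := by
  obtain ⟨F, hF, hFf⟩ := f.2
  let g : polydiscAlgebra d := ⟨⟨fun z => (f.1 z)⁻¹, f.1.continuous.inv₀ hf⟩, fun z => (F z)⁻¹,
    hF.inv fun z hz => hFf ⟨z, fun i => (hz i).le⟩ hz ▸ hf _,
    fun z hz => congrArg (·⁻¹) (hFf z hz)⟩
  refine IsUnit.of_mul_eq_one g (Subtype.ext (ContinuousMap.ext fun z => ?_))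
  exact mul_inv_cancel₀ (hf z)

theorem exists_apply_eq_of_algHom (χ : polydiscAlgebra d →ₐ[ℂ] ℂ) (f : polydiscAlgebra d) :
    ∃ z, χ f = f.1 z := by
  by_contra! hne
  have hunit : IsUnit (f - algebraMap ℂ _ (χ f)) :=
    isUnit_of_forall_apply_ne_zero fun z => sub_ne_zero.2 (hne z).symm
  exact (hunit.map χ).ne_zero (by simp)

theorem continuous_algHom_polydiscAlgebra (χ : polydiscAlgebra d →ₐ[ℂ] ℂ) : Continuous χ :=
  AddMonoidHomClass.continuous_of_bound χ 1 fun f => by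
    obtain ⟨z, hz⟩ := exists_apply_eq_of_algHom χ f
    rw [hz, one_mul]
    exact f.1.norm_coe_le_norm z

theorem exists_eq_evalAlgHom_polydiscAlgebra (χ : polydiscAlgebra d →ₐ[ℂ] ℂ) :
    ∃ z, χ = evalAlgHom (polydiscAlgebra d) z := by
  have hnorm : ∀ i, ‖χ (coordinate i)‖ ≤ 1 := fun i => by
    obtain ⟨z, hz⟩ := exists_apply_eq_of_algHom χ (coordinate i)
    exact hz ▸ z.2 i
  let z : ClosedPolydisc d := ⟨fun i => χ (coordinate i), hnorm⟩
  have hcoord : Set.EqOn χ (evalAlgHom (polydiscAlgebra d) z) (Set.range coordinate) := by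
    rintro _ ⟨i, rfl⟩
    rfl
  exact ⟨z, DFunLike.ext' <| (continuous_algHom_polydiscAlgebra χ).ext_on
    (dense_adjoin_coordinate d) (continuous_evalAlgHom _ z) (AlgHom.eqOn_adjoin_iff.2 hcoord)⟩

end PolydiscCharacters

section SymmetricCharacters

theorem continuous_permute (σ : Equiv.Perm (Fin d)) : Continuous (permute σ) :=
  continuous_induced_rng.2 <|
    continuous_pi fun i => (continuous_apply (σ i)).comp continuous_subtype_val

theorem apply_permute (f : symPolydiscAlgebra d) (σ : Equiv.Perm (Fin d))
    (z : ClosedPolydisc d) : f.1 (permute σ z) = f.1 z :=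
  congrFun ((f.1.continuous.comp (continuous_permute σ)).ext_on (dense_openPolydisc d)
    f.1.continuous fun w hw => (f.2.2 w hw σ).symm) z

theorem comp_permute_mem_polydiscAlgebra {f : C(ClosedPolydisc d, ℂ)}
    (hf : f ∈ polydiscAlgebra d) (σ : Equiv.Perm (Fin d)) :
    f.comp ⟨permute σ, continuous_permute σ⟩ ∈ polydiscAlgebra d := by
  obtain ⟨F, hF, hFf⟩ := hf
  exact ⟨fun z => F fun i => z (σ i), hF.comp (by fun_prop) fun z hz i => hz (σ i),
    fun z hz => hFf (permute σ z) fun i => hz (σ i)⟩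

/-- Composition with a permutation of the coordinates, as an automorphism of the polydisc algebra.
It is multiplicative in the permutation because `σ ↦ permute σ` is a right action. -/
noncomputable def permuteAlgEquiv (d : ℕ) :
    Equiv.Perm (Fin d) →* (polydiscAlgebra d ≃ₐ[ℂ] polydiscAlgebra d) where
  toFun σ :=
    { toFun := fun f => ⟨_, comp_permute_mem_polydiscAlgebra f.2 σ⟩
      invFun := fun f => ⟨_, comp_permute_mem_polydiscAlgebra f.2 σ⁻¹⟩
      left_inv := fun f => by
        ext z
        simp [permute]
      right_inv := fun f => by
        ext z
        simp [permute]
      map_mul' := fun _ _ => rfl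
      map_add' := fun _ _ => rfl
      commutes' := fun _ => rfl }
  map_one' := rfl
  map_mul' _ _ := rfl

theorem symPolydiscAlgebra_le (d : ℕ) : symPolydiscAlgebra d ≤ polydiscAlgebra d :=
  fun _ hf => hf.1

theorem mem_range_inclusion_iff_forall_permuteAlgEquiv_eq (f : polydiscAlgebra d) :
    f ∈ (Subalgebra.inclusion (symPolydiscAlgebra_le d)).range ↔
      ∀ σ, permuteAlgEquiv d σ f = f := by
  constructor
  · rintro ⟨f, rfl⟩ σ
    exact Subtype.ext (ContinuousMap.ext (apply_permute f σ))
  · intro hf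
    exact ⟨⟨f.1, f.2, fun z _ σ => congrArg (fun g => g.1 z) (hf σ).symm⟩, rfl⟩

theorem exists_eq_evalAlgHom_symPolydiscAlgebra (φ : symPolydiscAlgebra d →ₐ[ℂ] ℂ) :
    ∃ z, φ = evalAlgHom (symPolydiscAlgebra d) z := by
  obtain ⟨ψ, rfl⟩ := exists_algHom_comp_eq_of_isIntegral
    (Subalgebra.inclusion_injective (symPolydiscAlgebra_le d))
    (isIntegral_of_forall_fixed_mem_range fun f =>
      (mem_range_inclusion_iff_forall_permuteAlgEquiv_eq f).2) φ
  obtain ⟨z, rfl⟩ := exists_eq_evalAlgHom_polydiscAlgebra ψ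
  exact ⟨z, rfl⟩

theorem exists_eq_permute_of_forall_apply_eq {z w : ClosedPolydisc d}
    (h : ∀ f : symPolydiscAlgebra d, f.1 z = f.1 w) : ∃ σ, w = permute σ z := by
  obtain ⟨σ, hσ⟩ := exists_comp_algEquiv_eq_of_comp_eq (ρ := permuteAlgEquiv d)
    mem_range_inclusion_iff_forall_permuteAlgEquiv_eq
    (ψ := evalAlgHom (polydiscAlgebra d) z) (χ := evalAlgHom (polydiscAlgebra d) w)
    (AlgHom.ext h)
  exact ⟨σ, Subtype.ext (funext fun i => (DFunLike.congr_fun hσ (coordinate i)).symm)⟩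

end SymmetricCharacters

theorem exists_algHom_coe_eq_of_ne_zero {R A B : Type*} [CommSemiring R] [Semiring A]
    [Algebra R A] [Semiring B] [IsLeftCancelMulZero B] [Algebra R B] {φ : A →ₙₐ[R] B} (hφ : φ ≠ 0) :
    ∃ ψ : A →ₐ[R] B, ⇑ψ = φ := by
  obtain ⟨a, ha⟩ := DFunLike.ne_iff.1 hφ
  have hone : φ 1 = 1 := mul_left_cancel₀ ha (by rw [← map_mul, mul_one, mul_one])
  exact ⟨AlgHom.ofLinearMap (φ : A →ₗ[R] B) hone (map_mul φ), rfl⟩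

theorem continuous_nonUnitalAlgHom_of_ne_zero {φ : symPolydiscAlgebra d →ₙₐ[ℂ] ℂ} (hφ : φ ≠ 0) :
    Continuous φ := by
  obtain ⟨ψ, hψ⟩ := exists_algHom_coe_eq_of_ne_zero hφ
  obtain ⟨z, rfl⟩ := exists_eq_evalAlgHom_symPolydiscAlgebra ψ
  exact hψ ▸ continuous_evalAlgHom _ z

/-- The map `[z] ↦ (f ↦ f z)` from the orbit space to the Gelfand spectrum. -/
noncomputable def orbitEval (d : ℕ) :
    OrbitSpace d → WeakDual.characterSpace ℂ (symPolydiscAlgebra d) :=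
  Quotient.lift (evalCharacter _) (by
    rintro z _ ⟨σ, rfl⟩
    exact WeakDual.CharacterSpace.ext fun f => (apply_permute f σ z).symm)

theorem continuous_orbitEval (d : ℕ) : Continuous (orbitEval d) :=
  (continuous_evalCharacter _).quotient_lift _

theorem bijective_orbitEval (d : ℕ) : Function.Bijective (orbitEval d) := by
  constructor
  · rintro ⟨z⟩ ⟨w⟩ h
    exact Quotient.sound (exists_eq_permute_of_forall_apply_eq (DFunLike.congr_fun h))
  · intro φ
    obtain ⟨z, hz⟩ :=
      exists_eq_evalAlgHom_symPolydiscAlgebra (WeakDual.CharacterSpace.toAlgHom φ)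
    exact ⟨Quotient.mk _ z, WeakDual.CharacterSpace.ext fun f => (DFunLike.congr_fun hz f).symm⟩

end SymPolydisc

theorem theorem3p4 (d : ℕ) :
    (∀ φ : SymPolydisc.symPolydiscAlgebra d →ₙₐ[ℂ] ℂ, φ ≠ 0 → Continuous φ) ∧
    ∃ ι : SymPolydisc.OrbitSpace d ≃ₜ
        WeakDual.characterSpace ℂ (SymPolydisc.symPolydiscAlgebra d),
      ∀ (z : SymPolydisc.ClosedPolydisc d) (f : SymPolydisc.symPolydiscAlgebra d),
        ι (Quotient.mk (SymPolydisc.orbitSetoid d) z) f = f.1 z := by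
  refine ⟨fun _ => SymPolydisc.continuous_nonUnitalAlgHom_of_ne_zero, ?_⟩
  let e := Equiv.ofBijective _ (SymPolydisc.bijective_orbitEval d)
  have he : Continuous e := SymPolydisc.continuous_orbitEval d
  exact ⟨he.homeoOfEquivCompactToT2, fun _ _ => rfl⟩
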